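/- An additive symmetric monoidal category is a symmetric monoidal category $(\mathbb X,\otimes,K,\sigma)$ enriched in commutative monoids (each hom-set is a commutative monoid $(+,0)$, and composition and $\otimes$ are additive in each variable; neither negatives nor biproducts are assumed). Composition is written in diagrammatic order and coherence isomorphisms are suppressed. A coalgebra modality $(!,\delta,\varepsilon,\Delta,e)$ is a comonad $(!,\delta,\varepsilon)$ with natural transformations $\Delta\colon !A\to !A\otimes !A$ and $e\colon !A\to K$ such that each $(!A,\Delta,e)$ is a cocommutative comonoid and $\delta\Delta=\Delta(\delta\otimes\delta)$. A monoidal coalgebra modality $(!,\delta,\varepsilon,m_\otimes,m_K,\Delta,e)$ is a coalgebra modality with a natural transformation $m_\otimes\colon !A\otimes !B\to !(A\otimes B)$ and a map $m_K\colon K\to !K$ such that $(!,m_\otimes,m_K)$ is a (lax) symmetric monoidal endofunctor, $\delta,\varepsilon,\Delta,e$ are monoidal transformations, and $\Delta,e$ are $!$-coalgebra morphisms, i.e. $\delta\,!(\Delta)=\Delta(\delta\otimes\delta)m_\otimes$ and $\delta\,!(e)=e\,m_K$. An additive bialgebra modality $(!,\delta,\varepsilon,\Delta,e,\nabla,u)$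 is a coalgebra modality with natural transformations $\nabla\colon !A\otimes !A\to !A$ and $u\colon K\to !A$ such that each $(!A,\nabla,u)$ is a commutative monoid, each $(!A,\nabla,u,\Delta,e)$ is a bialgebra, $\nabla\varepsilon=\varepsilon\otimes e+e\otimes\varepsilon$, and, for all parallel $f,g\colon A\to B$, $!(f+g)=\Delta(!(f)\otimes !(g))\nabla$ and $!(0)=e\,u$. Theorem. On every additive symmetric monoidal category, monoidal coalgebra modalities correspond bijectively to additive bialgebra modalities. The bijection leaves the underlying coalgebra modality $(!,\delta,\varepsilon,\Delta,e)$ unchanged; it sends $(m_\otimes,m_K)$ to $$\nabla:=(\delta\otimes\delta)\,m_\otimes\,!(\varepsilon\otimes e+e\otimes\varepsilon),\qquad u:=m_K\,!(0),$$ and its inverse sends $(\nabla,u)$ to $$m_\otimes:=(\delta\otimes\delta)\,(!(1\otimes u)\otimes !(u\otimes 1))\,\nabla\,\delta\,!(\Delta)\,!(!(\varepsilon\otimes e)\otimes !(e\otimes\varepsilon))\,!(\varepsilon\otimes\varepsilon),\qquad m_K:=u\,\delta\,!(e).$$ Consequently, additive linear categories (additive symmetric monoidal categories equipped with a monoidal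 coalgebra modality) are the same as additive symmetric monoidal categories equipped with an additive bialgebra modality: the bijections above assemble to a bijection between the two that is the identity on the underlying additive symmetric monoidal category. -/

import Mathlib

open CategoryTheory MonoidalCategory

universe v u

/-- A category enriched in commutative monoids (no negatives and no biproducts are assumed). -/
class CMonCategory (C : Type u) [Category.{v} C] where
  homAddCommMonoid : ∀ A B : C, AddCommMonoid (A ⟶ B)
  add_comp : ∀ {A B D : C} (f g : A ⟶ B) (h : B ⟶ D), (f + g) ≫ h = f ≫ h + g ≫ h
  comp_add : ∀ {A B D : C} (k : A ⟶ B) (f g : B ⟶ D), k ≫ (f + g) = k ≫ f + k ≫ g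
  zero_comp : ∀ {A B D : C} (h : B ⟶ D), (0 : A ⟶ B) ≫ h = 0
  comp_zero : ∀ {A B D : C} (k : A ⟶ B), k ≫ (0 : B ⟶ D) = 0

attribute [reducible, instance] CMonCategory.homAddCommMonoid

/-- Compatibility of the tensor product with the additive structure: tensoring with an object on
either side is additive. Together with additivity of composition this is additivity of `⊗` in each
variable. -/
class AdditiveTensor (C : Type u) [Category.{v} C] [MonoidalCategory C] [CMonCategory C] :
    Prop where
  whiskerLeft_add : ∀ (D : C) {A B : C} (f g : A ⟶ B), D ◁ (f + g) = D ◁ f + D ◁ g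
  add_whiskerRight : ∀ {A B : C} (f g : A ⟶ B) (D : C), (f + g) ▷ D = f ▷ D + g ▷ D
  whiskerLeft_zero : ∀ D A B : C, D ◁ (0 : A ⟶ B) = 0
  zero_whiskerRight : ∀ A B D : C, (0 : A ⟶ B) ▷ D = 0

section

variable {C : Type u} [Category.{v} C]

/-- The component `δ : !A ⟶ !!A` of the comultiplication of a comonad. -/
abbrev comonadDelta (G : Comonad C) (A : C) : G.obj A ⟶ G.obj (G.obj A) := G.δ.app A

/-- The component `ε : !A ⟶ A` of the counit of a comonad. -/
abbrev comonadEps (G : Comonad C) (A : C) : G.obj A ⟶ A := G.ε.app A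

end

/-- A coalgebra modality `(!, δ, ε, Δ, e)` on a symmetric monoidal category: a comonad
`(!, δ, ε)`, called `bang`, with natural cocommutative comonoid structures `(!A, Δ, e)` such that
`δ` preserves the comultiplication. -/
structure CoalgebraModality (C : Type u) [Category.{v} C] [MonoidalCategory C]
    [SymmetricCategory C] where
  bang : Comonad C
  Δ : ∀ A : C, bang.obj A ⟶ bang.obj A ⊗ bang.obj A
  e : ∀ A : C, bang.obj A ⟶ 𝟙_ C
  Δ_natural : ∀ {A B : C} (f : A ⟶ B),
    bang.map f ≫ Δ B = Δ A ≫ (bang.map f ⊗ₘ bang.map f)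
  e_natural : ∀ {A B : C} (f : A ⟶ B), bang.map f ≫ e B = e A
  coassoc : ∀ A : C, Δ A ≫ bang.obj A ◁ Δ A =
    Δ A ≫ Δ A ▷ bang.obj A ≫ (α_ (bang.obj A) (bang.obj A) (bang.obj A)).hom
  counit_left : ∀ A : C, Δ A ≫ e A ▷ bang.obj A = (λ_ (bang.obj A)).inv
  counit_right : ∀ A : C, Δ A ≫ bang.obj A ◁ e A = (ρ_ (bang.obj A)).inv
  cocomm : ∀ A : C, Δ A ≫ (β_ (bang.obj A) (bang.obj A)).hom = Δ A
  δ_Δ : ∀ A : C, comonadDelta bang A ≫ Δ (bang.obj A) =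
    Δ A ≫ (comonadDelta bang A ⊗ₘ comonadDelta bang A)

namespace CoalgebraModality

variable {C : Type u} [Category.{v} C] [MonoidalCategory C] [SymmetricCategory C]

/-- The object `!A`. -/
abbrev obj (X : CoalgebraModality C) (A : C) : C := X.bang.obj A

/-- The morphism `!(f)`. -/
abbrev map (X : CoalgebraModality C) {A B : C} (f : A ⟶ B) : X.obj A ⟶ X.obj B := X.bang.map f

/-- `δ : !A ⟶ !!A`. -/
abbrev δ (X : CoalgebraModality C) (A : C) : X.obj A ⟶ X.obj (X.obj A) := comonadDelta X.bang A

/-- `ε : !A ⟶ A`. -/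
abbrev ε (X : CoalgebraModality C) (A : C) : X.obj A ⟶ A := comonadEps X.bang A

/-- `ε ⊗ e : !A ⊗ !B ⟶ A`, with `A ⊗ K` identified with `A`. -/
def εe (X : CoalgebraModality C) (A B : C) : X.obj A ⊗ X.obj B ⟶ A :=
  (X.ε A ⊗ₘ X.e B) ≫ (ρ_ A).hom

/-- `e ⊗ ε : !A ⊗ !B ⟶ B`, with `K ⊗ B` identified with `B`. -/
def eε (X : CoalgebraModality C) (A B : C) : X.obj A ⊗ X.obj B ⟶ B :=
  (X.e A ⊗ₘ X.ε B) ≫ (λ_ B).hom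

end CoalgebraModality

/-- The data `m_⊗`, `m_K` making a coalgebra modality a monoidal coalgebra modality:
`(!, m_⊗, m_K)` is a symmetric monoidal endofunctor, `δ`, `ε`, `Δ`, `e` are monoidal
transformations, and `Δ`, `e` are `!`-coalgebra morphisms. -/
@[ext]
structure MonoidalStructure {C : Type u} [Category.{v} C] [MonoidalCategory C]
    [SymmetricCategory C] (X : CoalgebraModality C) where
  mT : ∀ A B : C, X.obj A ⊗ X.obj B ⟶ X.obj (A ⊗ B)
  mK : 𝟙_ C ⟶ X.obj (𝟙_ C)
  -- `(!, m_⊗, m_K)` is a symmetric monoidal endofunctor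
  mT_natural : ∀ {A A' B B' : C} (f : A ⟶ A') (g : B ⟶ B'),
    (X.map f ⊗ₘ X.map g) ≫ mT A' B' = mT A B ≫ X.map (f ⊗ₘ g)
  mT_assoc : ∀ A B D : C, mT A B ▷ X.obj D ≫ mT (A ⊗ B) D ≫ X.map (α_ A B D).hom =
    (α_ (X.obj A) (X.obj B) (X.obj D)).hom ≫ X.obj A ◁ mT B D ≫ mT A (B ⊗ D)
  mT_unit_left : ∀ A : C,
    mK ▷ X.obj A ≫ mT (𝟙_ C) A ≫ X.map (λ_ A).hom = (λ_ (X.obj A)).hom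
  mT_unit_right : ∀ A : C,
    X.obj A ◁ mK ≫ mT A (𝟙_ C) ≫ X.map (ρ_ A).hom = (ρ_ (X.obj A)).hom
  mT_symm : ∀ A B : C, mT A B ≫ X.map (β_ A B).hom = (β_ (X.obj A) (X.obj B)).hom ≫ mT B A
  -- `δ` and `ε` are monoidal transformations
  mT_δ : ∀ A B : C, mT A B ≫ X.δ (A ⊗ B) =
    (X.δ A ⊗ₘ X.δ B) ≫ mT (X.obj A) (X.obj B) ≫ X.map (mT A B)
  mK_δ : mK ≫ X.δ (𝟙_ C) = mK ≫ X.map mK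
  mT_ε : ∀ A B : C, mT A B ≫ X.ε (A ⊗ B) = X.ε A ⊗ₘ X.ε B
  mK_ε : mK ≫ X.ε (𝟙_ C) = 𝟙 (𝟙_ C)
  -- `Δ` and `e` are monoidal transformations; `tensorμ` is `1 ⊗ σ ⊗ 1`
  mT_Δ : ∀ A B : C, mT A B ≫ X.Δ (A ⊗ B) =
    (X.Δ A ⊗ₘ X.Δ B) ≫ tensorμ (X.obj A) (X.obj A) (X.obj B) (X.obj B) ≫ (mT A B ⊗ₘ mT A B)
  mT_e : ∀ A B : C, mT A B ≫ X.e (A ⊗ B) = (X.e A ⊗ₘ X.e B) ≫ (λ_ (𝟙_ C)).hom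
  mK_Δ : mK ≫ X.Δ (𝟙_ C) = (λ_ (𝟙_ C)).inv ≫ (mK ⊗ₘ mK)
  mK_e : mK ≫ X.e (𝟙_ C) = 𝟙 (𝟙_ C)
  -- `Δ` and `e` are `!`-coalgebra morphisms
  Δ_coalg : ∀ A : C, X.δ A ≫ X.map (X.Δ A) =
    X.Δ A ≫ (X.δ A ⊗ₘ X.δ A) ≫ mT (X.obj A) (X.obj A)
  e_coalg : ∀ A : C, X.δ A ≫ X.map (X.e A) = X.e A ≫ mK

/-- The data `∇`, `u` making a coalgebra modality a bialgebra modality: natural commutative monoid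
structures `(!A, ∇, u)` such that `(!A, ∇, u, Δ, e)` is a bialgebra and
`∇ ε = ε ⊗ e + e ⊗ ε`. -/
@[ext]
structure BialgebraStructure {C : Type u} [Category.{v} C] [MonoidalCategory C]
    [SymmetricCategory C] [CMonCategory C] (X : CoalgebraModality C) where
  nabla : ∀ A : C, X.obj A ⊗ X.obj A ⟶ X.obj A
  unit : ∀ A : C, 𝟙_ C ⟶ X.obj A
  nabla_natural : ∀ {A B : C} (f : A ⟶ B),
    (X.map f ⊗ₘ X.map f) ≫ nabla B = nabla A ≫ X.map f
  unit_natural : ∀ {A B : C} (f : A ⟶ B), unit A ≫ X.map f = unit B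
  -- commutative monoid
  nabla_assoc : ∀ A : C, nabla A ▷ X.obj A ≫ nabla A =
    (α_ (X.obj A) (X.obj A) (X.obj A)).hom ≫ X.obj A ◁ nabla A ≫ nabla A
  unit_nabla : ∀ A : C, unit A ▷ X.obj A ≫ nabla A = (λ_ (X.obj A)).hom
  nabla_unit : ∀ A : C, X.obj A ◁ unit A ≫ nabla A = (ρ_ (X.obj A)).hom
  nabla_comm : ∀ A : C, (β_ (X.obj A) (X.obj A)).hom ≫ nabla A = nabla A
  -- bialgebra
  nabla_e : ∀ A : C, nabla A ≫ X.e A = (X.e A ⊗ₘ X.e A) ≫ (λ_ (𝟙_ C)).hom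
  unit_Δ : ∀ A : C, unit A ≫ X.Δ A = (λ_ (𝟙_ C)).inv ≫ (unit A ⊗ₘ unit A)
  unit_e : ∀ A : C, unit A ≫ X.e A = 𝟙 (𝟙_ C)
  nabla_Δ : ∀ A : C, nabla A ≫ X.Δ A =
    (X.Δ A ⊗ₘ X.Δ A) ≫ tensorμ (X.obj A) (X.obj A) (X.obj A) (X.obj A) ≫ (nabla A ⊗ₘ nabla A)
  -- compatibility of `ε` and `∇`
  nabla_ε : ∀ A : C, nabla A ≫ X.ε A = X.εe A A + X.eε A A

/-- The data `∇`, `u` making a coalgebra modality an additive bialgebra modality: a bialgebra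
modality with `!(f + g) = Δ (!(f) ⊗ !(g)) ∇` and `!(0) = e u`. -/
@[ext]
structure AdditiveBialgebraStructure {C : Type u} [Category.{v} C] [MonoidalCategory C]
    [SymmetricCategory C] [CMonCategory C] (X : CoalgebraModality C) extends
    BialgebraStructure X where
  map_add : ∀ {A B : C} (f g : A ⟶ B),
    X.map (f + g) = X.Δ A ≫ (X.map f ⊗ₘ X.map g) ≫ nabla B
  map_zero : ∀ A B : C, X.map (0 : A ⟶ B) = X.e A ≫ unit B

/-- A monoidal coalgebra modality `(!, δ, ε, m_⊗, m_K, Δ, e)`. -/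
structure MonoidalCoalgebraModality (C : Type u) [Category.{v} C] [MonoidalCategory C]
    [SymmetricCategory C] where
  coalg : CoalgebraModality C
  str : MonoidalStructure coalg

/-- An additive bialgebra modality `(!, δ, ε, Δ, e, ∇, u)`. -/
structure AdditiveBialgebraModality (C : Type u) [Category.{v} C] [MonoidalCategory C]
    [SymmetricCategory C] [CMonCategory C] where
  coalg : CoalgebraModality C
  str : AdditiveBialgebraStructure coalg

section Constructions

variable {C : Type u} [Category.{v} C] [MonoidalCategory C] [SymmetricCategory C] [CMonCategory C]

/-- `∇ := (δ ⊗ δ) m_⊗ !(ε ⊗ e + e ⊗ ε)`. -/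
def MonoidalStructure.inducedNabla {X : CoalgebraModality C} (M : MonoidalStructure X) (A : C) :
    X.obj A ⊗ X.obj A ⟶ X.obj A :=
  (X.δ A ⊗ₘ X.δ A) ≫ M.mT (X.obj A) (X.obj A) ≫ X.map (X.εe A A + X.eε A A)

/-- `u := m_K !(0)`. -/
def MonoidalStructure.inducedUnit {X : CoalgebraModality C} (M : MonoidalStructure X) (A : C) :
    𝟙_ C ⟶ X.obj A :=
  M.mK ≫ X.map (0 : 𝟙_ C ⟶ A)

/-- `m_⊗ := (δ ⊗ δ) (!(1 ⊗ u) ⊗ !(u ⊗ 1)) ∇ δ !(Δ) !(!(ε ⊗ e) ⊗ !(e ⊗ ε)) !(ε ⊗ ε)`. -/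
def BialgebraStructure.inducedMT {X : CoalgebraModality C} (S : BialgebraStructure X) (A B : C) :
    X.obj A ⊗ X.obj B ⟶ X.obj (A ⊗ B) :=
  (X.δ A ⊗ₘ X.δ B) ≫
    (X.map ((ρ_ (X.obj A)).inv ≫ X.obj A ◁ S.unit B) ⊗ₘ
      X.map ((λ_ (X.obj B)).inv ≫ S.unit A ▷ X.obj B)) ≫
    S.nabla (X.obj A ⊗ X.obj B) ≫
    X.δ (X.obj A ⊗ X.obj B) ≫
    X.map (X.Δ (X.obj A ⊗ X.obj B)) ≫
    X.map (X.map (X.εe A B) ⊗ₘ X.map (X.eε A B)) ≫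
    X.map (X.ε A ⊗ₘ X.ε B)

/-- `m_K := u δ !(e)`. -/
def BialgebraStructure.inducedMK {X : CoalgebraModality C} (S : BialgebraStructure X) :
    𝟙_ C ⟶ X.obj (𝟙_ C) :=
  S.unit (𝟙_ C) ≫ X.δ (𝟙_ C) ≫ X.map (X.e (𝟙_ C))

end Constructions

/-- An additive linear category: an additive symmetric monoidal category together with a monoidal
coalgebra modality. -/
structure AdditiveLinearCategory where
  carrier : Type u
  [category : Category.{v} carrier]
  [monoidal : MonoidalCategory carrier]
  [symmetric : SymmetricCategory carrier]
  [cmon : CMonCategory carrier]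
  [additive : AdditiveTensor carrier]
  modality : MonoidalCoalgebraModality carrier

/-- An additive symmetric monoidal category together with an additive bialgebra modality. -/
structure AdditiveBialgebraCategory where
  carrier : Type u
  [category : Category.{v} carrier]
  [monoidal : MonoidalCategory carrier]
  [symmetric : SymmetricCategory carrier]
  [cmon : CMonCategory carrier]
  [additive : AdditiveTensor carrier]
  modality : AdditiveBialgebraModality carrier

/-! Every `f : !W ⟶ A` has a cofree extension `lift f = δ !(f) : !W ⟶ !A`, and two maps out of `!W`
can be paired along `Δ`. On these generalised elements all four operations are forced: `m_⊗` sends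
`(lift f, lift g)` to `lift (pair f g)`, `∇` sends it to `lift (f + g)`, while `e m_K = lift e` and
`e u = lift 0`. Identities tested on such elements reduce to the calculus of `lift` and `pair`.

Such tests suffice: given an additive bialgebra structure, `!A ⊗ !B` is a retract of `!(!A ⊗ !B)`
(`coproj_comp_pair`), and `e` is split by `u`. This gives the monoidal axioms and both inverse laws.

Conversely, from a monoidal structure the retraction is not yet available. Instead `(δ ⊗ δ) m_⊗`
makes `!A ⊗ !A` a `!`-coalgebra and `∇` is the coalgebra morphism to `!A` extending `ε ⊗ e + e ⊗ ε`
(`inducedNabla_δ`); the associativity and unit laws are then checked inside `!`, where they concern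
only `ε` and `e`. -/

lemma tensorμ_unit_unit {C : Type u} [Category.{v} C] [MonoidalCategory C]
    [SymmetricCategory C] (P Q : C) :
    tensorμ P (𝟙_ C) (𝟙_ C) Q ≫ ((ρ_ P).hom ⊗ₘ (λ_ Q).hom) = (ρ_ P).hom ⊗ₘ (λ_ Q).hom := by
  rw [tensorμ, braiding_tensorUnit_left]
  monoidal

/-! ### Calculus of cofree extensions and pairings. -/

namespace CoalgebraModality

variable {C : Type u} [Category.{v} C] [MonoidalCategory C] [SymmetricCategory C]
  (X : CoalgebraModality C)

/-- The cofree extension `δ !(f)` of a map `f : !W ⟶ A`. -/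
def lift {W A : C} (f : X.obj W ⟶ A) : X.obj W ⟶ X.obj A := X.δ W ≫ X.map f

/-- The pairing `Δ (f ⊗ g)` of maps out of `!W`. -/
def pair {W P Q : C} (f : X.obj W ⟶ P) (g : X.obj W ⟶ Q) : X.obj W ⟶ P ⊗ Q :=
  X.Δ W ≫ (f ⊗ₘ g)

lemma δ_natural {A B : C} (f : A ⟶ B) : X.map f ≫ X.δ B = X.δ A ≫ X.map (X.map f) :=
  X.bang.δ.naturality f

lemma ε_natural {A B : C} (f : A ⟶ B) : X.map f ≫ X.ε B = X.ε A ≫ f :=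
  X.bang.ε.naturality f

lemma δ_ε (A : C) : X.δ A ≫ X.ε (X.obj A) = 𝟙 (X.obj A) := X.bang.left_counit A

lemma δ_map_ε (A : C) : X.δ A ≫ X.map (X.ε A) = 𝟙 (X.obj A) := X.bang.right_counit A

lemma δ_δ (A : C) : X.δ A ≫ X.δ (X.obj A) = X.δ A ≫ X.map (X.δ A) := (X.bang.coassoc A).symm

lemma map_comp {A B D : C} (f : A ⟶ B) (g : B ⟶ D) : X.map (f ≫ g) = X.map f ≫ X.map g :=
  X.bang.map_comp f g

lemma map_id (A : C) : X.map (𝟙 A) = 𝟙 (X.obj A) := X.bang.map_id A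

/-- Lets statements about cofree extensions be applied to maps `!(f)`. -/
lemma map_eq_lift {A B : C} (f : A ⟶ B) : X.map f = X.lift (X.ε A ≫ f) := by
  rw [lift, map_comp, ← Category.assoc, δ_map_ε, Category.id_comp]

lemma lift_ε_eq_id (A : C) : X.lift (X.ε A) = 𝟙 (X.obj A) := X.δ_map_ε A

@[simp]
lemma lift_comp_ε {W A : C} (f : X.obj W ⟶ A) : X.lift f ≫ X.ε A = f := by
  rw [lift, Category.assoc, ε_natural, ← Category.assoc, δ_ε, Category.id_comp]

@[simp]
lemma lift_comp_map {W A B : C} (f : X.obj W ⟶ A) (g : A ⟶ B) :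
    X.lift f ≫ X.map g = X.lift (f ≫ g) := by
  rw [lift, lift, map_comp, Category.assoc]

@[simp]
lemma lift_comp_δ {W A : C} (f : X.obj W ⟶ A) : X.lift f ≫ X.δ A = X.lift (X.lift f) := by
  rw [lift, Category.assoc, δ_natural, ← Category.assoc, δ_δ, Category.assoc, ← map_comp]
  rfl

lemma lift_comp_lift {W A B : C} (f : X.obj W ⟶ A) (g : X.obj A ⟶ B) :
    X.lift f ≫ X.lift g = X.lift (X.lift f ≫ g) := by
  rw [← lift_comp_map, ← lift_comp_δ, Category.assoc]
  rfl

/-- Not an axiom: it follows from naturality of `e` at `ε` and the counit law `δ !(ε) = 1`. -/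
lemma δ_e (A : C) : X.δ A ≫ X.e (X.obj A) = X.e A := by
  rw [← X.e_natural (X.ε A), ← Category.assoc, δ_map_ε, Category.id_comp]

@[simp]
lemma lift_comp_e {W A : C} (f : X.obj W ⟶ A) : X.lift f ≫ X.e A = X.e W := by
  rw [lift, Category.assoc, X.e_natural, δ_e]

@[simp]
lemma lift_comp_Δ {W A : C} (f : X.obj W ⟶ A) :
    X.lift f ≫ X.Δ A = X.pair (X.lift f) (X.lift f) := by
  rw [lift, Category.assoc, X.Δ_natural, ← Category.assoc, X.δ_Δ, Category.assoc,
    tensorHom_comp_tensorHom, pair]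

@[simp]
lemma pair_comp_tensorHom {W P Q R S : C} (f : X.obj W ⟶ P) (g : X.obj W ⟶ Q) (h : P ⟶ R)
    (k : Q ⟶ S) : X.pair f g ≫ (h ⊗ₘ k) = X.pair (f ≫ h) (g ≫ k) := by
  rw [pair, pair, Category.assoc, tensorHom_comp_tensorHom]

@[simp]
lemma pair_comp_whiskerLeft {W P Q S : C} (f : X.obj W ⟶ P) (g : X.obj W ⟶ Q) (k : Q ⟶ S) :
    X.pair f g ≫ P ◁ k = X.pair f (g ≫ k) := by
  rw [← id_tensorHom, pair_comp_tensorHom, Category.comp_id]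

@[simp]
lemma pair_comp_whiskerRight {W P Q R : C} (f : X.obj W ⟶ P) (g : X.obj W ⟶ Q) (h : P ⟶ R) :
    X.pair f g ≫ h ▷ Q = X.pair (f ≫ h) g := by
  rw [← tensorHom_id, pair_comp_tensorHom, Category.comp_id]

/-- Cofree extensions preserve `Δ`, so substitution along them distributes over pairing; an
arbitrary map into `!A` need not. -/
lemma lift_comp_pair {W A P Q : C} (h : X.obj W ⟶ A) (f : X.obj A ⟶ P) (g : X.obj A ⟶ Q) :
    X.lift h ≫ X.pair f g = X.pair (X.lift h ≫ f) (X.lift h ≫ g) := by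
  rw [← pair_comp_tensorHom, ← lift_comp_Δ, Category.assoc, pair]

@[simp]
lemma pair_comp_braiding {W P Q : C} (f : X.obj W ⟶ P) (g : X.obj W ⟶ Q) :
    X.pair f g ≫ (β_ P Q).hom = X.pair g f := by
  rw [pair, Category.assoc, BraidedCategory.braiding_naturality, ← Category.assoc, X.cocomm, pair]

@[simp]
lemma pair_comp_associator {W P Q R : C} (f : X.obj W ⟶ P) (g : X.obj W ⟶ Q)
    (h : X.obj W ⟶ R) :
    X.pair (X.pair f g) h ≫ (α_ P Q R).hom = X.pair f (X.pair g h) := by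
  have hl : X.pair (X.pair f g) h =
      X.Δ W ≫ X.Δ W ▷ X.obj W ≫ ((f ⊗ₘ g) ⊗ₘ h) := by
    rw [whiskerRight_comp_tensorHom]; rfl
  have hr : X.pair f (X.pair g h) = X.Δ W ≫ X.obj W ◁ X.Δ W ≫ (f ⊗ₘ (g ⊗ₘ h)) := by
    rw [whiskerLeft_comp_tensorHom]; rfl
  rw [hl, hr, ← Category.assoc (X.Δ W) (_ ◁ _), X.coassoc]
  simp only [Category.assoc, associator_naturality]

@[simp]
lemma pair_comp_associator_inv {W P Q R : C} (f : X.obj W ⟶ P) (g : X.obj W ⟶ Q)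
    (h : X.obj W ⟶ R) :
    X.pair f (X.pair g h) ≫ (α_ P Q R).inv = X.pair (X.pair f g) h := by
  rw [Iso.comp_inv_eq, pair_comp_associator]

@[simp]
lemma pair_comp_tensorμ {W P Q R S : C} (f : X.obj W ⟶ P) (g : X.obj W ⟶ Q)
    (h : X.obj W ⟶ R) (k : X.obj W ⟶ S) :
    X.pair (X.pair f g) (X.pair h k) ≫ tensorμ P Q R S =
      X.pair (X.pair f h) (X.pair g k) := by
  simp only [tensorμ, ← Category.assoc, pair_comp_associator, pair_comp_whiskerLeft,
    pair_comp_whiskerRight, pair_comp_associator_inv, pair_comp_braiding]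

lemma pair_e_left {W Q : C} (g : X.obj W ⟶ Q) : X.pair (X.e W) g = g ≫ (λ_ Q).inv := by
  have : X.pair (X.e W) g = X.Δ W ≫ X.e W ▷ X.obj W ≫ (𝟙_ C) ◁ g := by
    rw [pair, MonoidalCategory.tensorHom_def]
  rw [this, ← Category.assoc, X.counit_left, leftUnitor_inv_naturality]

lemma pair_e_right {W P : C} (f : X.obj W ⟶ P) : X.pair f (X.e W) = f ≫ (ρ_ P).inv := by
  have : X.pair f (X.e W) = X.Δ W ≫ X.obj W ◁ X.e W ≫ f ▷ (𝟙_ C) := by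
    rw [pair, MonoidalCategory.tensorHom_def']
  rw [this, ← Category.assoc, X.counit_right, rightUnitor_inv_naturality]

/-- `ε ⊗ e` acts as a first projection only when the discarded component preserves `e`, hence the
hypothesis. -/
lemma pair_comp_εe {W A B : C} (f : X.obj W ⟶ X.obj A) (g : X.obj W ⟶ X.obj B)
    (hg : g ≫ X.e B = X.e W) : X.pair f g ≫ X.εe A B = f ≫ X.ε A := by
  rw [εe, ← Category.assoc, pair_comp_tensorHom, hg, pair_e_right, Category.assoc, Iso.inv_hom_id,
    Category.comp_id]

lemma pair_comp_eε {W A B : C} (f : X.obj W ⟶ X.obj A) (g : X.obj W ⟶ X.obj B)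
    (hf : f ≫ X.e A = X.e W) : X.pair f g ≫ X.eε A B = g ≫ X.ε B := by
  rw [eε, ← Category.assoc, pair_comp_tensorHom, hf, pair_e_left, Category.assoc, Iso.inv_hom_id,
    Category.comp_id]

lemma tensorHom_comp_εe {P Q A B : C} (f : P ⟶ X.obj A) (g : Q ⟶ X.obj B) :
    (f ⊗ₘ g) ≫ X.εe A B = (f ≫ X.ε A ⊗ₘ g ≫ X.e B) ≫ (ρ_ A).hom := by
  rw [εe, ← Category.assoc, tensorHom_comp_tensorHom]

lemma tensorHom_comp_eε {P Q A B : C} (f : P ⟶ X.obj A) (g : Q ⟶ X.obj B) :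
    (f ⊗ₘ g) ≫ X.eε A B = (f ≫ X.e A ⊗ₘ g ≫ X.ε B) ≫ (λ_ B).hom := by
  rw [eε, ← Category.assoc, tensorHom_comp_tensorHom]

lemma map_tensor_εe {A B A' B' : C} (f : A ⟶ A') (g : B ⟶ B') :
    (X.map f ⊗ₘ X.map g) ≫ X.εe A' B' = X.εe A B ≫ f := by
  rw [tensorHom_comp_εe, ε_natural, X.e_natural, εe, Category.assoc, ← rightUnitor_naturality,
    ← Category.assoc, ← tensorHom_id, tensorHom_comp_tensorHom, Category.comp_id]

lemma map_tensor_eε {A B A' B' : C} (f : A ⟶ A') (g : B ⟶ B') :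
    (X.map f ⊗ₘ X.map g) ≫ X.eε A' B' = X.eε A B ≫ g := by
  rw [tensorHom_comp_eε, ε_natural, X.e_natural, eε, Category.assoc, ← leftUnitor_naturality,
    ← Category.assoc, ← id_tensorHom, tensorHom_comp_tensorHom, Category.comp_id]

lemma braiding_comp_εe (A B : C) : (β_ (X.obj B) (X.obj A)).hom ≫ X.εe A B = X.eε B A := by
  rw [εe, eε, ← Category.assoc, ← BraidedCategory.braiding_naturality, Category.assoc,
    braiding_rightUnitor]

lemma braiding_comp_eε (A B : C) : (β_ (X.obj B) (X.obj A)).hom ≫ X.eε A B = X.εe B A := by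
  rw [εe, eε, ← Category.assoc, ← BraidedCategory.braiding_naturality, Category.assoc,
    braiding_leftUnitor]

end CoalgebraModality

/-! ### Coprojections built from the unit. -/

namespace BialgebraStructure

open CoalgebraModality

variable {C : Type u} [Category.{v} C] [MonoidalCategory C] [SymmetricCategory C]
  [CMonCategory C] {X : CoalgebraModality C} (S : BialgebraStructure X)

/-- By naturality `u = u !(0)`, and `!(0) ε = ε 0 = 0`. -/
lemma unit_ε (A : C) : S.unit A ≫ X.ε A = 0 := by
  rw [← S.unit_natural (0 : A ⟶ A), Category.assoc, X.ε_natural, CMonCategory.comp_zero,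
    CMonCategory.comp_zero]

/-- The coprojection `1 ⊗ u : !A ⟶ !A ⊗ !B`. -/
def inl (A B : C) : X.obj A ⟶ X.obj A ⊗ X.obj B := (ρ_ (X.obj A)).inv ≫ X.obj A ◁ S.unit B

/-- The coprojection `u ⊗ 1 : !B ⟶ !A ⊗ !B`. -/
def inr (A B : C) : X.obj B ⟶ X.obj A ⊗ X.obj B := (λ_ (X.obj B)).inv ≫ S.unit A ▷ X.obj B

lemma inl_eq_pair (A B : C) : S.inl A B = X.pair (𝟙 _) (X.e A ≫ S.unit B) := by
  rw [← pair_comp_whiskerLeft, pair_e_right, Category.id_comp, inl]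

lemma inr_eq_pair (A B : C) : S.inr A B = X.pair (X.e B ≫ S.unit A) (𝟙 _) := by
  rw [← pair_comp_whiskerRight, pair_e_left, Category.id_comp, inr]

lemma e_unit_e (A B : C) : (X.e A ≫ S.unit B) ≫ X.e B = X.e A := by
  rw [Category.assoc, S.unit_e, Category.comp_id]

lemma e_unit_ε (A B : C) : (X.e A ≫ S.unit B) ≫ X.ε B = 0 := by
  rw [Category.assoc, S.unit_ε, CMonCategory.comp_zero]

lemma inl_εe (A B : C) : S.inl A B ≫ X.εe A B = X.ε A := by
  rw [inl_eq_pair, pair_comp_εe _ _ _ (S.e_unit_e A B), Category.id_comp]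

lemma inl_eε (A B : C) : S.inl A B ≫ X.eε A B = 0 := by
  rw [inl_eq_pair, pair_comp_eε _ _ _ (Category.id_comp _), e_unit_ε]

lemma inr_eε (A B : C) : S.inr A B ≫ X.eε A B = X.ε B := by
  rw [inr_eq_pair, pair_comp_eε _ _ _ (S.e_unit_e B A), Category.id_comp]

lemma inr_εe (A B : C) : S.inr A B ≫ X.εe A B = 0 := by
  rw [inr_eq_pair, pair_comp_εe _ _ _ (Category.id_comp _), e_unit_ε]

/-- Displays `m_⊗` as the section of the retract `!A ⊗ !B` of `!(!A ⊗ !B)`, followed by the cofree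
extension of the retraction composed with `ε ⊗ ε`. -/
lemma inducedMT_eq (A B : C) : S.inducedMT A B =
    (X.lift (S.inl A B) ⊗ₘ X.lift (S.inr A B)) ≫ S.nabla _ ≫
      X.lift (X.pair (X.map (X.εe A B)) (X.map (X.eε A B)) ≫ (X.ε A ⊗ₘ X.ε B)) := by
  simp only [inducedMT, inl, inr, lift, pair, X.map_comp, ← tensorHom_comp_tensorHom,
    Category.assoc]

end BialgebraStructure

/-! ### From additive bialgebra structures to monoidal structures. -/

namespace AdditiveBialgebraStructure

open CoalgebraModality

variable {C : Type u} [Category.{v} C] [MonoidalCategory C] [SymmetricCategory C]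
  [CMonCategory C] {X : CoalgebraModality C} (S : AdditiveBialgebraStructure X)

lemma lift_add {W A : C} (f g : X.obj W ⟶ A) :
    X.pair (X.lift f) (X.lift g) ≫ S.nabla A = X.lift (f + g) := by
  -- With the identity of `!W` the cofree extension is `δ`, so `h` moves `δ` inside the pairing.
  have h := lift_comp_pair X (𝟙 (X.obj W)) (X.map f) (X.map g)
  simp only [lift_comp_map, Category.id_comp] at h
  rw [← h, ← Category.id_comp (f + g), ← lift_comp_map, S.map_add, Category.assoc, pair,
    Category.assoc]

lemma lift_zero (W A : C) : X.lift (0 : X.obj W ⟶ A) = X.e W ≫ S.unit A := by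
  rw [lift, S.map_zero, ← Category.assoc, X.δ_e]

lemma lift_pair_comp_coproj {W A B : C} (f : X.obj W ⟶ A) (g : X.obj W ⟶ B) :
    X.pair (X.lift f) (X.lift g) ≫ (X.lift (S.inl A B) ⊗ₘ X.lift (S.inr A B)) ≫ S.nabla _ =
      X.lift (X.lift f ≫ S.inl A B + X.lift g ≫ S.inr A B) := by
  rw [← Category.assoc, pair_comp_tensorHom, lift_comp_lift, lift_comp_lift, S.lift_add]

/-- The matrix identities between `inl`, `inr` and `εe`, `eε` recover each component from the sum.
-/
lemma lift_sum_comp_pair {W A B : C} (f : X.obj W ⟶ A) (g : X.obj W ⟶ B) :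
    X.lift (X.lift f ≫ S.inl A B + X.lift g ≫ S.inr A B) ≫
      X.pair (X.map (X.εe A B)) (X.map (X.eε A B)) = X.pair (X.lift f) (X.lift g) := by
  rw [lift_comp_pair]
  simp only [lift_comp_map, CMonCategory.add_comp, Category.assoc, S.inl_εe, S.inl_eε, S.inr_εe,
    S.inr_eε, CMonCategory.comp_zero, add_zero, zero_add, lift_comp_ε]

/-- The induced `m_⊗` turns the pairing of cofree extensions into a cofree extension. -/
lemma lift_pair_comp_inducedMT {W A B : C} (f : X.obj W ⟶ A) (g : X.obj W ⟶ B) :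
    X.pair (X.lift f) (X.lift g) ≫ S.inducedMT A B = X.lift (X.pair f g) := by
  rw [S.inducedMT_eq, ← Category.assoc (_ ⊗ₘ _), ← Category.assoc, S.lift_pair_comp_coproj,
    lift_comp_lift, ← Category.assoc, S.lift_sum_comp_pair, pair_comp_tensorHom, lift_comp_ε,
    lift_comp_ε]

lemma id_tensor_e_unit_comp_nabla (A B : C) :
    (𝟙 (X.obj A) ⊗ₘ X.e B ≫ S.unit A) ≫ S.nabla A = (𝟙 (X.obj A) ⊗ₘ X.e B) ≫ (ρ_ _).hom := by
  rw [← S.nabla_unit, ← Category.assoc, ← id_tensorHom, tensorHom_comp_tensorHom,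
    Category.comp_id]

lemma e_unit_tensor_id_comp_nabla (A B : C) :
    (X.e A ≫ S.unit B ⊗ₘ 𝟙 (X.obj B)) ≫ S.nabla B = (X.e A ⊗ₘ 𝟙 (X.obj B)) ≫ (λ_ _).hom := by
  rw [← S.unit_nabla, ← Category.assoc, ← tensorHom_id, tensorHom_comp_tensorHom,
    Category.comp_id]

/-- `!A ⊗ !B` is a retract of `!(!A ⊗ !B)`. -/
lemma coproj_comp_pair (A B : C) :
    ((X.lift (S.inl A B) ⊗ₘ X.lift (S.inr A B)) ≫ S.nabla _) ≫
      X.pair (X.map (X.εe A B)) (X.map (X.eε A B)) = 𝟙 (X.obj A ⊗ X.obj B) := by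
  have hΔ : (X.lift (S.inl A B) ⊗ₘ X.lift (S.inr A B)) ≫ (X.Δ _ ⊗ₘ X.Δ _) =
      (X.Δ A ⊗ₘ X.Δ B) ≫ ((X.lift (S.inl A B) ⊗ₘ X.lift (S.inl A B)) ⊗ₘ
        (X.lift (S.inr A B) ⊗ₘ X.lift (S.inr A B))) := by
    simp only [tensorHom_comp_tensorHom, lift_comp_Δ, pair]
  -- After projecting, one factor is `lift ε = 1` and the other is `lift 0 = e u`, whose `u` is
  -- absorbed by `∇`.
  have hl : (X.lift (S.inl A B) ⊗ₘ X.lift (S.inr A B)) ≫ S.nabla _ ≫ X.map (X.εe A B) =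
      (𝟙 _ ⊗ₘ X.e B) ≫ (ρ_ _).hom := by
    rw [← S.nabla_natural, ← Category.assoc, tensorHom_comp_tensorHom, lift_comp_map,
      lift_comp_map, S.inl_εe, S.inr_εe, S.lift_zero, lift_ε_eq_id,
      S.id_tensor_e_unit_comp_nabla]
  have hr : (X.lift (S.inl A B) ⊗ₘ X.lift (S.inr A B)) ≫ S.nabla _ ≫ X.map (X.eε A B) =
      (X.e A ⊗ₘ 𝟙 _) ≫ (λ_ _).hom := by
    rw [← S.nabla_natural, ← Category.assoc, tensorHom_comp_tensorHom, lift_comp_map,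
      lift_comp_map, S.inl_eε, S.inr_eε, S.lift_zero, lift_ε_eq_id,
      S.e_unit_tensor_id_comp_nabla]
  have hc : (X.Δ A ⊗ₘ X.Δ B) ≫ ((𝟙 _ ⊗ₘ X.e A) ⊗ₘ (X.e B ⊗ₘ 𝟙 _)) =
      ((ρ_ (X.obj A)).inv ⊗ₘ (λ_ (X.obj B)).inv) := by
    rw [tensorHom_comp_tensorHom, id_tensorHom, tensorHom_id, X.counit_left, X.counit_right]
  -- The bialgebra law rewrites `∇ Δ`, so that the two legs become `hl` and `hr`; the middle
  -- exchange is then trivial on `K ⊗ K`, and the counit laws finish.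
  rw [Category.assoc, pair, ← Category.assoc (S.nabla _), S.nabla_Δ]
  simp only [Category.assoc, tensorHom_comp_tensorHom]
  rw [← Category.assoc, hΔ, Category.assoc, ← Category.assoc (_ ⊗ₘ _) (tensorμ _ _ _ _),
    tensorμ_natural, Category.assoc, tensorHom_comp_tensorHom, hl, hr,
    ← tensorHom_comp_tensorHom, ← Category.assoc (tensorμ _ _ _ _), ← tensorμ_natural,
    Category.assoc, tensorμ_unit_unit, ← Category.assoc, hc, tensorHom_comp_tensorHom,
    Iso.inv_hom_id, Iso.inv_hom_id, id_tensorHom_id]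

/-- Maps out of `!A ⊗ !B` are determined by their composites with pairings of cofree
extensions. -/
lemma hom_ext_tensor (S : AdditiveBialgebraStructure X) {A B Z : C} {h k : X.obj A ⊗ X.obj B ⟶ Z}
    (H : ∀ (W : C) (f : X.obj W ⟶ A) (g : X.obj W ⟶ B),
      X.pair (X.lift f) (X.lift g) ≫ h = X.pair (X.lift f) (X.lift g) ≫ k) : h = k := by
  rw [← Category.id_comp h, ← Category.id_comp k, ← S.coproj_comp_pair, X.map_eq_lift,
    X.map_eq_lift]
  simp only [Category.assoc, H]

/-- Maps out of `(!A ⊗ !B) ⊗ !D` are determined by their composites with iterated pairings of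
cofree extensions. -/
lemma hom_ext_tensor_tensor (S : AdditiveBialgebraStructure X) {A B D Z : C}
    {h k : (X.obj A ⊗ X.obj B) ⊗ X.obj D ⟶ Z}
    (H : ∀ (W : C) (f : X.obj W ⟶ A) (g : X.obj W ⟶ B) (l : X.obj W ⟶ D),
      X.pair (X.pair (X.lift f) (X.lift g)) (X.lift l) ≫ h =
        X.pair (X.pair (X.lift f) (X.lift g)) (X.lift l) ≫ k) : h = k := by
  -- The retraction replaces `!A ⊗ !B` by a single `!(!A ⊗ !B)`, leaving a two-fold tensor.
  have key : X.pair (X.map (X.εe A B)) (X.map (X.eε A B)) ▷ X.obj D ≫ h =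
      X.pair (X.map (X.εe A B)) (X.map (X.eε A B)) ▷ X.obj D ≫ k := by
    apply S.hom_ext_tensor
    intro W f g
    simp only [← Category.assoc, pair_comp_whiskerRight, lift_comp_pair, lift_comp_map, H]
  rw [← Category.id_comp h, ← Category.id_comp k, ← id_whiskerRight, ← S.coproj_comp_pair,
    comp_whiskerRight, Category.assoc, Category.assoc, key]

/-- The map `e` is a split epimorphism. -/
lemma hom_ext_unit (S : AdditiveBialgebraStructure X) (A : C) {Z : C} {h k : 𝟙_ C ⟶ Z}
    (H : X.e A ≫ h = X.e A ≫ k) : h = k := by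
  rw [← Category.id_comp h, ← Category.id_comp k, ← S.unit_e A, Category.assoc, Category.assoc, H]

lemma e_comp_inducedMK (A : C) : X.e A ≫ S.inducedMK = X.lift (X.e A) := by
  rw [BialgebraStructure.inducedMK, ← Category.assoc, ← S.lift_zero, ← Category.assoc,
    lift_comp_δ, lift_comp_map, lift_comp_e]

lemma inducedMT_natural {A A' B B' : C} (f : A ⟶ A') (g : B ⟶ B') :
    (X.map f ⊗ₘ X.map g) ≫ S.inducedMT A' B' = S.inducedMT A B ≫ X.map (f ⊗ₘ g) := by
  apply S.hom_ext_tensor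
  intro W a b
  simp only [← Category.assoc, pair_comp_tensorHom, lift_comp_map, S.lift_pair_comp_inducedMT]

lemma inducedMT_Δ (A B : C) : S.inducedMT A B ≫ X.Δ (A ⊗ B) =
    (X.Δ A ⊗ₘ X.Δ B) ≫ tensorμ (X.obj A) (X.obj A) (X.obj B) (X.obj B) ≫
      (S.inducedMT A B ⊗ₘ S.inducedMT A B) := by
  apply S.hom_ext_tensor
  intro W a b
  simp only [← Category.assoc, pair_comp_tensorHom, lift_comp_Δ, pair_comp_tensorμ,
    S.lift_pair_comp_inducedMT]

/-- The monoidal structure induced by an additive bialgebra structure. -/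
def toMonoidalStructure : MonoidalStructure X where
  mT A B := S.inducedMT A B
  mK := S.inducedMK
  mT_natural := S.inducedMT_natural
  mT_assoc A B D := by
    apply S.hom_ext_tensor_tensor
    intro W a b c
    simp only [← Category.assoc, pair_comp_whiskerRight, pair_comp_associator,
      pair_comp_whiskerLeft, S.lift_pair_comp_inducedMT, lift_comp_map]
  mT_unit_left A := by
    -- Precomposing with the inverse unitor gives the pairing of `e` with `lift ε = 1`, on which
    -- `m_K` and `m_⊗` are known.
    rw [← cancel_epi (λ_ (X.obj A)).inv, Iso.inv_hom_id, ← Category.id_comp (λ_ _).inv,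
      ← lift_ε_eq_id, ← pair_e_left, ← Category.assoc, pair_comp_whiskerRight,
      S.e_comp_inducedMK, ← Category.assoc, S.lift_pair_comp_inducedMT, lift_comp_map,
      pair_e_left, Category.assoc, Iso.inv_hom_id, Category.comp_id]
  mT_unit_right A := by
    rw [← cancel_epi (ρ_ (X.obj A)).inv, Iso.inv_hom_id, ← Category.id_comp (ρ_ _).inv,
      ← lift_ε_eq_id, ← pair_e_right, ← Category.assoc, pair_comp_whiskerLeft,
      S.e_comp_inducedMK, ← Category.assoc, S.lift_pair_comp_inducedMT, lift_comp_map,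
      pair_e_right, Category.assoc, Iso.inv_hom_id, Category.comp_id]
  mT_symm A B := by
    apply S.hom_ext_tensor
    intro W a b
    simp only [← Category.assoc, pair_comp_braiding, S.lift_pair_comp_inducedMT, lift_comp_map]
  mT_δ A B := by
    apply S.hom_ext_tensor
    intro W a b
    simp only [← Category.assoc, pair_comp_tensorHom, S.lift_pair_comp_inducedMT, lift_comp_map,
      lift_comp_δ]
  mK_δ := by
    apply S.hom_ext_unit (𝟙_ C)
    simp only [← Category.assoc, S.e_comp_inducedMK, lift_comp_δ, lift_comp_map]
  mT_ε A B := by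
    apply S.hom_ext_tensor
    intro W a b
    simp only [← Category.assoc, pair_comp_tensorHom, S.lift_pair_comp_inducedMT, lift_comp_ε]
  mK_ε := by
    apply S.hom_ext_unit (𝟙_ C)
    simp only [← Category.assoc, S.e_comp_inducedMK, lift_comp_ε, Category.comp_id]
  mT_Δ := S.inducedMT_Δ
  mT_e A B := by
    apply S.hom_ext_tensor
    intro W a b
    simp only [← Category.assoc, pair_comp_tensorHom, S.lift_pair_comp_inducedMT, lift_comp_e,
      pair_e_left]
    simp
  mK_Δ := by
    apply S.hom_ext_unit (𝟙_ C)
    simp only [← Category.assoc, S.e_comp_inducedMK, lift_comp_Δ, ← pair_e_left,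
      pair_comp_tensorHom]
  mK_e := by
    apply S.hom_ext_unit (𝟙_ C)
    simp only [← Category.assoc, S.e_comp_inducedMK, lift_comp_e, Category.comp_id]
  Δ_coalg A := by
    -- The coalgebra condition on `Δ` is the formula for `m_⊗` at two identities.
    have h := S.lift_pair_comp_inducedMT (𝟙 (X.obj A)) (𝟙 (X.obj A))
    simp only [lift, pair, X.map_id, Category.comp_id, id_tensorHom_id, Category.assoc] at h
    exact h.symm
  e_coalg A := (S.e_comp_inducedMK A).symm

end AdditiveBialgebraStructure

/-! ### From monoidal structures to additive bialgebra structures. -/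

namespace MonoidalStructure

open CoalgebraModality

variable {C : Type u} [Category.{v} C] [MonoidalCategory C] [SymmetricCategory C]
  {X : CoalgebraModality C} (M : MonoidalStructure X)

/-- This is `Δ` being a coalgebra morphism, combined with naturality of `m_⊗`; it is the formula
that also characterises the induced `m_⊗`. -/
lemma lift_pair_comp_mT {W A B : C} (f : X.obj W ⟶ A) (g : X.obj W ⟶ B) :
    X.pair (X.lift f) (X.lift g) ≫ M.mT A B = X.lift (X.pair f g) := by
  rw [lift, lift, lift, ← pair_comp_tensorHom, Category.assoc, M.mT_natural, pair, pair,
    X.map_comp, ← Category.assoc (X.δ W), M.Δ_coalg]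
  simp only [Category.assoc]

lemma e_comp_mK (A : C) : X.e A ≫ M.mK = X.lift (X.e A) := (M.e_coalg A).symm

/-- The associator is a coalgebra morphism between the two bracketings of the triple tensor of `!A`.
-/
lemma mT_δ_assoc (A : C) :
    ((X.δ A ⊗ₘ X.δ A) ≫ M.mT _ _ ⊗ₘ X.δ A) ≫ M.mT _ _ ≫ X.map (α_ _ _ _).hom =
      (α_ _ _ _).hom ≫ (X.δ A ⊗ₘ (X.δ A ⊗ₘ X.δ A) ≫ M.mT _ _) ≫ M.mT _ _ := by
  have hl : ((X.δ A ⊗ₘ X.δ A) ≫ M.mT (X.obj A) (X.obj A) ⊗ₘ X.δ A) =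
      ((X.δ A ⊗ₘ X.δ A) ⊗ₘ X.δ A) ≫ M.mT _ _ ▷ _ := by
    rw [← tensorHom_id, tensorHom_comp_tensorHom, Category.comp_id]
  have hr : (X.δ A ⊗ₘ (X.δ A ⊗ₘ X.δ A) ≫ M.mT (X.obj A) (X.obj A)) =
      (X.δ A ⊗ₘ (X.δ A ⊗ₘ X.δ A)) ≫ _ ◁ M.mT _ _ := by
    rw [← id_tensorHom, tensorHom_comp_tensorHom, Category.comp_id]
  rw [hl, hr, Category.assoc, M.mT_assoc, associator_naturality_assoc, Category.assoc]

variable [CMonCategory C]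

lemma inducedNabla_natural {A B : C} (f : A ⟶ B) :
    (X.map f ⊗ₘ X.map f) ≫ M.inducedNabla B = M.inducedNabla A ≫ X.map f := by
  have h : (X.map f ⊗ₘ X.map f) ≫ (X.εe B B + X.eε B B) = (X.εe A A + X.eε A A) ≫ f := by
    rw [CMonCategory.comp_add, CMonCategory.add_comp, map_tensor_εe, map_tensor_eε]
  simp only [inducedNabla, Category.assoc]
  rw [← X.map_comp, ← h, X.map_comp, ← Category.assoc (M.mT _ _), ← M.mT_natural,
    ← Category.assoc, tensorHom_comp_tensorHom, δ_natural, ← tensorHom_comp_tensorHom]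
  simp only [Category.assoc]

lemma inducedUnit_natural {A B : C} (f : A ⟶ B) :
    M.inducedUnit A ≫ X.map f = M.inducedUnit B := by
  rw [inducedUnit, Category.assoc, ← X.map_comp, CMonCategory.zero_comp, inducedUnit]

lemma inducedNabla_ε (A : C) : M.inducedNabla A ≫ X.ε A = X.εe A A + X.eε A A := by
  rw [inducedNabla, Category.assoc, Category.assoc, ε_natural, ← Category.assoc (M.mT _ _),
    M.mT_ε, ← Category.assoc, tensorHom_comp_tensorHom, δ_ε, id_tensorHom_id, Category.id_comp]

lemma inducedNabla_e (A : C) :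
    M.inducedNabla A ≫ X.e A = (X.e A ⊗ₘ X.e A) ≫ (λ_ (𝟙_ C)).hom := by
  rw [inducedNabla, Category.assoc, Category.assoc, X.e_natural, M.mT_e, ← Category.assoc,
    tensorHom_comp_tensorHom, δ_e]

lemma inducedUnit_ε (A : C) : M.inducedUnit A ≫ X.ε A = 0 := by
  rw [inducedUnit, Category.assoc, ε_natural, CMonCategory.comp_zero, CMonCategory.comp_zero]

lemma inducedUnit_e (A : C) : M.inducedUnit A ≫ X.e A = 𝟙 (𝟙_ C) := by
  rw [inducedUnit, Category.assoc, X.e_natural, M.mK_e]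

lemma inducedUnit_Δ (A : C) : M.inducedUnit A ≫ X.Δ A =
    (λ_ (𝟙_ C)).inv ≫ (M.inducedUnit A ⊗ₘ M.inducedUnit A) := by
  rw [inducedUnit, Category.assoc, X.Δ_natural, ← Category.assoc, M.mK_Δ, Category.assoc,
    tensorHom_comp_tensorHom]

/-- `∇` is a morphism of `!`-coalgebras. -/
lemma inducedNabla_δ (A : C) : M.inducedNabla A ≫ X.δ A =
    (X.δ A ⊗ₘ X.δ A) ≫ M.mT _ _ ≫ X.map (M.inducedNabla A) := by
  -- Coassociativity of `δ` in both factors, after which naturality moves `m_⊗` past `!(δ) ⊗ !(δ)`.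
  have h : (X.δ A ⊗ₘ X.δ A) ≫ (X.δ _ ⊗ₘ X.δ _) =
      (X.δ A ⊗ₘ X.δ A) ≫ (X.map (X.δ A) ⊗ₘ X.map (X.δ A)) := by
    rw [tensorHom_comp_tensorHom, tensorHom_comp_tensorHom, δ_δ]
  simp only [inducedNabla, Category.assoc, δ_natural, X.map_comp]
  rw [← Category.assoc (M.mT _ _), M.mT_δ]
  simp only [Category.assoc]
  rw [← Category.assoc (_ ⊗ₘ _), h, Category.assoc, ← Category.assoc (_ ⊗ₘ _) (M.mT _ _),
    M.mT_natural, Category.assoc]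

/-- `u` is a morphism of `!`-coalgebras. -/
lemma inducedUnit_δ (A : C) : M.inducedUnit A ≫ X.δ A = M.mK ≫ X.map (M.inducedUnit A) := by
  rw [inducedUnit, Category.assoc, δ_natural, ← Category.assoc, M.mK_δ, Category.assoc,
    ← X.map_comp]

lemma inducedNabla_comm (A : C) :
    (β_ (X.obj A) (X.obj A)).hom ≫ M.inducedNabla A = M.inducedNabla A := by
  have h : (β_ (X.obj A) (X.obj A)).hom ≫ (X.εe A A + X.eε A A) = X.εe A A + X.eε A A := by
    rw [CMonCategory.comp_add, braiding_comp_εe, braiding_comp_eε, add_comm]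
  rw [inducedNabla, ← Category.assoc, ← BraidedCategory.braiding_naturality, Category.assoc,
    ← Category.assoc _ (M.mT _ _), ← M.mT_symm, Category.assoc, ← X.map_comp, h]

lemma inducedNabla_Δ (A : C) : M.inducedNabla A ≫ X.Δ A =
    (X.Δ A ⊗ₘ X.Δ A) ≫ tensorμ (X.obj A) (X.obj A) (X.obj A) (X.obj A) ≫
      (M.inducedNabla A ⊗ₘ M.inducedNabla A) := by
  have h : (X.δ A ⊗ₘ X.δ A) ≫ (X.Δ _ ⊗ₘ X.Δ _) =
      (X.Δ A ⊗ₘ X.Δ A) ≫ ((X.δ A ⊗ₘ X.δ A) ⊗ₘ (X.δ A ⊗ₘ X.δ A)) := by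
    rw [tensorHom_comp_tensorHom, tensorHom_comp_tensorHom, X.δ_Δ]
  simp only [inducedNabla, Category.assoc, X.Δ_natural]
  rw [← Category.assoc (M.mT _ _), M.mT_Δ]
  simp only [Category.assoc]
  rw [← Category.assoc (_ ⊗ₘ _), h, Category.assoc, ← Category.assoc (_ ⊗ₘ _) (tensorμ _ _ _ _),
    tensorμ_natural]
  simp only [Category.assoc, tensorHom_comp_tensorHom]

/-- Writing `!(f)` and `!(g)` as cofree extensions, `m_⊗` pairs them inside `!`, where `ε ⊗ e + e ⊗
ε` adds the two components. -/
lemma map_add (M : MonoidalStructure X) {A B : C} (f g : A ⟶ B) :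
    X.map (f + g) = X.Δ A ≫ (X.map f ⊗ₘ X.map g) ≫ M.inducedNabla B := by
  rw [← Category.assoc]
  change _ = X.pair _ _ ≫ _
  rw [X.map_eq_lift f, X.map_eq_lift g, inducedNabla, ← Category.assoc, pair_comp_tensorHom,
    lift_comp_δ, lift_comp_δ, ← Category.assoc, M.lift_pair_comp_mT, lift_comp_map,
    CMonCategory.comp_add, pair_comp_εe _ _ _ (lift_comp_e _ _),
    pair_comp_eε _ _ _ (lift_comp_e _ _), lift_comp_ε, lift_comp_ε, ← CMonCategory.comp_add,
    ← X.map_eq_lift]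

lemma map_zero (M : MonoidalStructure X) (A B : C) :
    X.map (0 : A ⟶ B) = X.e A ≫ M.inducedUnit B := by
  rw [inducedUnit, ← Category.assoc, M.e_comp_mK, lift_comp_map, X.map_eq_lift,
    CMonCategory.comp_zero, CMonCategory.comp_zero]

/-- Since `u` is a coalgebra morphism it can be moved inside `!`; there `u ε = 0` kills one summand,
`u e = 1` simplifies the other, and the unit law of `m_⊗` remains. -/
lemma inducedUnit_inducedNabla [AdditiveTensor C] (A : C) :
    M.inducedUnit A ▷ X.obj A ≫ M.inducedNabla A = (λ_ (X.obj A)).hom := by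
  have h : (M.inducedUnit A ⊗ₘ 𝟙 (X.obj A)) ≫ (X.εe A A + X.eε A A) =
      (λ_ (X.obj A)).hom ≫ X.ε A := by
    rw [CMonCategory.comp_add, tensorHom_comp_εe, tensorHom_comp_eε, inducedUnit_ε, inducedUnit_e,
      MonoidalCategory.tensorHom_def, AdditiveTensor.zero_whiskerRight, CMonCategory.zero_comp,
      CMonCategory.zero_comp, zero_add, id_tensorHom, Category.id_comp, leftUnitor_naturality]
  rw [inducedNabla, ← tensorHom_id, ← Category.assoc, tensorHom_comp_tensorHom, inducedUnit_δ,
    Category.id_comp, ← Category.comp_id (X.δ A), ← X.map_id, ← tensorHom_comp_tensorHom,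
    Category.assoc, ← Category.assoc (_ ⊗ₘ _) (M.mT _ _), M.mT_natural, Category.assoc,
    ← X.map_comp, h, MonoidalCategory.tensorHom_def', Category.assoc, X.map_comp,
    ← Category.assoc (M.mT _ _), ← Category.assoc (_ ▷ _), M.mT_unit_left,
    leftUnitor_naturality_assoc, δ_map_ε, Category.comp_id]

lemma inducedNabla_inducedUnit [AdditiveTensor C] (A : C) :
    X.obj A ◁ M.inducedUnit A ≫ M.inducedNabla A = (ρ_ (X.obj A)).hom := by
  rw [← M.inducedNabla_comm, BraidedCategory.braiding_naturality_right_assoc,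
    M.inducedUnit_inducedNabla, braiding_leftUnitor]

/-- Since `∇` is a coalgebra morphism, the inner product moves inside `!`, reducing associativity to
an identity before applying `!`. -/
lemma whiskerRight_inducedNabla_comp (A : C) :
    M.inducedNabla A ▷ X.obj A ≫ M.inducedNabla A =
      ((X.δ A ⊗ₘ X.δ A) ≫ M.mT _ _ ⊗ₘ X.δ A) ≫ M.mT _ _ ≫
        X.map ((M.inducedNabla A ⊗ₘ 𝟙 (X.obj A)) ≫ (X.εe A A + X.eε A A)) := by
  rw [X.map_comp, ← Category.assoc (M.mT _ _), ← M.mT_natural, Category.assoc, ← Category.assoc,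
    tensorHom_comp_tensorHom, Category.assoc, ← M.inducedNabla_δ, X.map_id, Category.comp_id,
    ← tensorHom_id]
  -- Only the outer product is unfolded.
  nth_rw 2 [inducedNabla]
  rw [← Category.assoc, tensorHom_comp_tensorHom, Category.id_comp]

lemma whiskerLeft_inducedNabla_comp (A : C) :
    X.obj A ◁ M.inducedNabla A ≫ M.inducedNabla A =
      (X.δ A ⊗ₘ (X.δ A ⊗ₘ X.δ A) ≫ M.mT _ _) ≫ M.mT _ _ ≫
        X.map ((𝟙 (X.obj A) ⊗ₘ M.inducedNabla A) ≫ (X.εe A A + X.eε A A)) := by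
  rw [X.map_comp, ← Category.assoc (M.mT _ _), ← M.mT_natural, Category.assoc, ← Category.assoc,
    tensorHom_comp_tensorHom, Category.assoc, ← M.inducedNabla_δ, X.map_id, Category.comp_id,
    ← id_tensorHom]
  nth_rw 2 [inducedNabla]
  rw [← Category.assoc, tensorHom_comp_tensorHom, Category.id_comp]

/-- Both sides expand to the same three summands, with `ε` on one factor and `e` on the other two.
-/
lemma inducedNabla_tensor_comp_add [AdditiveTensor C] (A : C) :
    (M.inducedNabla A ⊗ₘ 𝟙 (X.obj A)) ≫ (X.εe A A + X.eε A A) =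
      (α_ _ _ _).hom ≫ (𝟙 (X.obj A) ⊗ₘ M.inducedNabla A) ≫ (X.εe A A + X.eε A A) := by
  have h₁ : ((X.ε A ⊗ₘ X.e A) ≫ (ρ_ _).hom ⊗ₘ X.e A) ≫ (ρ_ _).hom =
      (α_ _ _ _).hom ≫ (X.ε A ⊗ₘ (X.e A ⊗ₘ X.e A) ≫ (λ_ _).hom) ≫ (ρ_ _).hom := by
    monoidal
  have h₂ : ((X.e A ⊗ₘ X.ε A) ≫ (λ_ _).hom ⊗ₘ X.e A) ≫ (ρ_ _).hom =
      (α_ _ _ _).hom ≫ (X.e A ⊗ₘ (X.ε A ⊗ₘ X.e A) ≫ (ρ_ _).hom) ≫ (λ_ _).hom := by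
    monoidal
  have h₃ : ((X.e A ⊗ₘ X.e A) ≫ (λ_ _).hom ⊗ₘ X.ε A) ≫ (λ_ _).hom =
      (α_ _ _ _).hom ≫ (X.e A ⊗ₘ (X.e A ⊗ₘ X.ε A) ≫ (λ_ _).hom) ≫ (λ_ _).hom := by
    monoidal
  simp only [CMonCategory.comp_add, tensorHom_comp_εe, tensorHom_comp_eε, inducedNabla_ε,
    inducedNabla_e, Category.id_comp]
  have hadd : ∀ {P Q R S : C} (f g : P ⟶ Q) (h : R ⟶ S),
      ((f + g) ⊗ₘ h) = (f ⊗ₘ h) + (g ⊗ₘ h) := by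
    intro P Q R S f g h
    simp only [MonoidalCategory.tensorHom_def, AdditiveTensor.add_whiskerRight,
      CMonCategory.add_comp]
  have hadd' : ∀ {P Q R S : C} (f g : P ⟶ Q) (h : R ⟶ S),
      (h ⊗ₘ (f + g)) = (h ⊗ₘ f) + (h ⊗ₘ g) := by
    intro P Q R S f g h
    simp only [MonoidalCategory.tensorHom_def, AdditiveTensor.whiskerLeft_add,
      CMonCategory.comp_add]
  simp only [hadd, hadd', CMonCategory.add_comp, CMonCategory.comp_add]
  simp only [εe, eε]
  rw [h₁, h₂, h₃, add_assoc]

lemma inducedNabla_assoc [AdditiveTensor C] (A : C) :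
    M.inducedNabla A ▷ X.obj A ≫ M.inducedNabla A =
      (α_ (X.obj A) (X.obj A) (X.obj A)).hom ≫ X.obj A ◁ M.inducedNabla A ≫
        M.inducedNabla A := by
  rw [whiskerRight_inducedNabla_comp, whiskerLeft_inducedNabla_comp,
    inducedNabla_tensor_comp_add, X.map_comp, ← Category.assoc (M.mT _ _), ← Category.assoc,
    M.mT_δ_assoc]
  simp only [Category.assoc]

/-- The additive bialgebra structure induced by a monoidal structure. -/
def toAdditiveBialgebraStructure [AdditiveTensor C] : AdditiveBialgebraStructure X where
  nabla A := M.inducedNabla A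
  unit A := M.inducedUnit A
  nabla_natural := M.inducedNabla_natural
  unit_natural := M.inducedUnit_natural
  nabla_assoc := M.inducedNabla_assoc
  unit_nabla := M.inducedUnit_inducedNabla
  nabla_unit := M.inducedNabla_inducedUnit
  nabla_comm := M.inducedNabla_comm
  nabla_e := M.inducedNabla_e
  unit_Δ := M.inducedUnit_Δ
  unit_e := M.inducedUnit_e
  nabla_Δ := M.inducedNabla_Δ
  nabla_ε := M.inducedNabla_ε
  map_add := M.map_add
  map_zero := M.map_zero

/-! ### The constructions are mutually inverse. -/

lemma toMonoidalStructure_toAdditiveBialgebraStructure [AdditiveTensor C] :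
    M.toAdditiveBialgebraStructure.toMonoidalStructure = M := by
  ext
  · apply M.toAdditiveBialgebraStructure.hom_ext_tensor
    intro W f g
    rw [M.lift_pair_comp_mT]
    exact M.toAdditiveBialgebraStructure.lift_pair_comp_inducedMT f g
  · apply M.toAdditiveBialgebraStructure.hom_ext_unit (𝟙_ C)
    rw [M.e_comp_mK]
    exact M.toAdditiveBialgebraStructure.e_comp_inducedMK (𝟙_ C)

end MonoidalStructure

lemma AdditiveBialgebraStructure.toAdditiveBialgebraStructure_toMonoidalStructure {C : Type u}
    [Category.{v} C] [MonoidalCategory C] [SymmetricCategory C] [CMonCategory C]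
    [AdditiveTensor C] {X : CoalgebraModality C} (S : AdditiveBialgebraStructure X) :
    S.toMonoidalStructure.toAdditiveBialgebraStructure = S := by
  ext A
  · apply S.hom_ext_tensor
    intro W f g
    change _ ≫ S.toMonoidalStructure.inducedNabla A = _
    -- Both products send the pairing of `lift f` and `lift g` to `lift (f + g)`.
    rw [S.lift_add, MonoidalStructure.inducedNabla, ← Category.assoc,
      CoalgebraModality.pair_comp_tensorHom, CoalgebraModality.lift_comp_δ,
      CoalgebraModality.lift_comp_δ, ← Category.assoc, MonoidalStructure.lift_pair_comp_mT,
      CoalgebraModality.lift_comp_map, CMonCategory.comp_add,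
      CoalgebraModality.pair_comp_εe _ _ _ (CoalgebraModality.lift_comp_e _ _),
      CoalgebraModality.pair_comp_eε _ _ _ (CoalgebraModality.lift_comp_e _ _),
      CoalgebraModality.lift_comp_ε, CoalgebraModality.lift_comp_ε]
  · apply S.hom_ext_unit A
    -- Both units satisfy `e u = !(0)`.
    rw [← S.map_zero, ← AdditiveBialgebraStructure.map_zero]

/-- The correspondence between monoidal coalgebra modalities and additive bialgebra modalities. -/
def monoidalEquivAdditiveBialgebra (C : Type u) [Category.{v} C] [MonoidalCategory C]
    [SymmetricCategory C] [CMonCategory C] [AdditiveTensor C] :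
    MonoidalCoalgebraModality C ≃ AdditiveBialgebraModality C where
  toFun M := ⟨M.coalg, M.str.toAdditiveBialgebraStructure⟩
  invFun S := ⟨S.coalg, S.str.toMonoidalStructure⟩
  left_inv M := by
    dsimp only
    rw [M.str.toMonoidalStructure_toAdditiveBialgebraStructure]
  right_inv S := by
    dsimp only
    rw [S.str.toAdditiveBialgebraStructure_toMonoidalStructure]

/-- The correspondence between additive linear categories and additive symmetric monoidal
categories with an additive bialgebra modality. -/
def additiveLinearEquivAdditiveBialgebra :
    AdditiveLinearCategory.{v, u} ≃ AdditiveBialgebraCategory.{v, u} where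
  toFun L :=
    letI := L.category
    letI := L.monoidal
    letI := L.symmetric
    letI := L.cmon
    letI := L.additive
    ⟨L.carrier, monoidalEquivAdditiveBialgebra L.carrier L.modality⟩
  invFun L :=
    letI := L.category
    letI := L.monoidal
    letI := L.symmetric
    letI := L.cmon
    letI := L.additive
    ⟨L.carrier, (monoidalEquivAdditiveBialgebra L.carrier).symm L.modality⟩
  left_inv L := by
    dsimp only
    rw [Equiv.symm_apply_apply]
  right_inv L := by
    dsimp only
    rw [Equiv.apply_symm_apply]


theorem mainTheorem1 :
    ∃ Ψ : ∀ (C : Type u) [Category.{v} C] [MonoidalCategory C] [SymmetricCategory C]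
        [CMonCategory C] [AdditiveTensor C],
        MonoidalCoalgebraModality C ≃ AdditiveBialgebraModality C,
      -- on every additive symmetric monoidal category, `Ψ` and its inverse keep `(!, δ, ε, Δ, e)`
      -- and are given by the stated formulas
      (∀ (C : Type u) [Category.{v} C] [MonoidalCategory C] [SymmetricCategory C]
          [CMonCategory C] [AdditiveTensor C] (X : CoalgebraModality C),
        (∀ M : MonoidalStructure X, ∃ S : AdditiveBialgebraStructure X,
          Ψ C ⟨X, M⟩ = ⟨X, S⟩ ∧
          (∀ A : C, S.nabla A = M.inducedNabla A) ∧
          (∀ A : C, S.unit A = M.inducedUnit A)) ∧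
        (∀ S : AdditiveBialgebraStructure X, ∃ M : MonoidalStructure X,
          (Ψ C).symm ⟨X, S⟩ = ⟨X, M⟩ ∧
          (∀ A B : C, M.mT A B = S.inducedMT A B) ∧
          M.mK = S.inducedMK)) ∧
      -- hence additive linear categories are the same as additive symmetric monoidal categories
      -- with an additive bialgebra modality
      (∃ Θ : AdditiveLinearCategory.{v, u} ≃ AdditiveBialgebraCategory.{v, u},
        ∀ (C : Type u) [Category.{v} C] [MonoidalCategory C] [SymmetricCategory C]
          [CMonCategory C] [AdditiveTensor C] (M : MonoidalCoalgebraModality C),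
          Θ (AdditiveLinearCategory.mk C M) = AdditiveBialgebraCategory.mk C (Ψ C M)) := by
  exact ⟨fun C => monoidalEquivAdditiveBialgebra C,
    fun C _ _ _ _ _ X =>
      ⟨fun M => ⟨M.toAdditiveBialgebraStructure, rfl, fun _ => rfl, fun _ => rfl⟩,
        fun S => ⟨S.toMonoidalStructure, rfl, fun _ _ => rfl, rfl⟩⟩,
    additiveLinearEquivAdditiveBialgebra, fun C _ _ _ _ _ M => rfl⟩
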